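/- Let $\Delta=\{z\in\mathbb C:|z|<1\}$. By an infinite discrete subset of a complex manifold $X$ we mean an infinite subset without accumulation points in $X$ (i.e. closed, with discrete subspace topology). An exhaustion function on $X$ is a continuous function $\rho:X\to[0,\infty)$ all of whose sublevel sets $\{\rho\le c\}$ are compact. An infinite discrete subset $D\subset X$ is called (weakly) tame if for every exhaustion function $\rho$ on $X$ and every map $\zeta:D\to[0,\infty)$ there is a holomorphic automorphism $\phi$ of $X$ with $\rho(\phi(x))\ge\zeta(x)$ for all $x\in D$. Two subsets $D,D'\subset X$ are called equivalent if $\phi(D)=D'$ for some holomorphic automorphism $\phi$ of $X$. The complex manifold $\Delta\times\mathbb C$ admits two tame discrete subsets which are not equivalent. More precisely: (i) for every infinite discrete subset $D\subset\Delta$, the set $D\times\{0\}$ is a tame discrete subset of $\Delta\times\mathbb C$; (ii) if $D,D'\subset\Delta$ are infinite discrete subsets which are not equivalent in $\Delta$ (no holomorphic automorphism of $\Delta$ maps $D$ onto $D'$), then $D\times\{0\}$ and $D'\times\{0\}$ are not equivalent in $\Delta\times\mathbb C$; and (iii) there exist infinite discrete subsets $D,D'\subset\Delta$ which are not equivalent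 in $\Delta$. -/

import Mathlib

open scoped Manifold ContDiff NNReal
open TopologicalSpace

namespace TameSets

section General

variable {E : Type*} [NormedAddCommGroup E] [NormedSpace ℂ E] {H : Type*} [TopologicalSpace H]
  (I : ModelWithCorners ℂ E H) {X : Type*} [TopologicalSpace X] [ChartedSpace H X]

/-- The holomorphic automorphisms of a complex manifold: complex analytic bijections with
complex analytic inverse. -/
abbrev HolAut (I : ModelWithCorners ℂ E H) (X : Type*) [TopologicalSpace X]
    [ChartedSpace H X] : Type _ :=
  X ≃ₘ^ω⟮I, I⟯ X

/-- An infinite discrete subset, in the sense of complex analysis: it has no accumulation point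
in the whole space, that is, it is closed and its subspace topology is discrete. -/
structure IsInfiniteDiscreteSubset {X : Type*} [TopologicalSpace X] (D : Set X) : Prop where
  infinite : D.Infinite
  isClosed : IsClosed D
  discrete : DiscreteTopology D

/-- An exhaustion function: a continuous nonnegative function with compact sublevel sets. -/
structure IsExhaustion {X : Type*} [TopologicalSpace X] (ρ : X → ℝ≥0) : Prop where
  continuous : Continuous ρ
  isCompact_sublevel : ∀ c : ℝ≥0, IsCompact {x | ρ x ≤ c}

/-- (Weakly) tame discrete subsets of a complex manifold. -/
structure IsTame (D : Set X) : Prop where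
  isInfiniteDiscreteSubset : IsInfiniteDiscreteSubset D
  exists_aut : ∀ ρ : X → ℝ≥0, IsExhaustion ρ → ∀ ζ : D → ℝ≥0,
    ∃ φ : HolAut I X, ∀ x : D, ζ x ≤ ρ (φ (x : X))

/-- Two subsets of a complex manifold are equivalent if some holomorphic automorphism of the
manifold maps the first one onto the second one. -/
def AreEquivalent (D D' : Set X) : Prop :=
  ∃ φ : HolAut I X, φ '' D = D'

end General

/-- The open unit disc, as an open submanifold of the complex plane. -/
abbrev unitDisc : Opens ℂ := ⟨Metric.ball 0 1, Metric.isOpen_ball⟩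

/-- The model of the product complex manifold `unitDisc × ℂ`. -/
noncomputable abbrev discTimesPlaneModel : ModelWithCorners ℂ (ℂ × ℂ) (ModelProd ℂ ℂ) :=
  𝓘(ℂ, ℂ).prod 𝓘(ℂ, ℂ)

end TameSets

/-! Tameness: a holomorphic `f` on the disc can take any prescribed values on `D`, so the shear `(z,
w) ↦ (z, w + f z)` moves each `(z, 0)` as far up its noncompact fibre as required. Inequivalence: by
Liouville, an automorphism of the product maps each fibre `{z} × ℂ` into a fibre, hence descends to
an automorphism of the disc. Inequivalent sets in the disc: the Blaschke condition is
automorphism-invariant by the Schwarz lemma, and it separates the points `1 - 1/(n+2)` from `1 -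
2^(-n-1)`. -/

namespace TameSets

open Set Filter Topology

/-! ### Interpolation by polynomial series -/

section Interpolation

/-- The correction is a Lagrange product killing the earlier nodes, times `(z / a n) ^ k`. On `‖z‖ ≤
‖a n‖ ^ 2` the last factor is at most `‖a n‖ ^ k`, so a large `k` makes it small; these radii still
tend to 1 when `‖a n‖` does. -/
theorem exists_polynomial_interpolate_step (a : ℕ → ℂ) (ha : Function.Injective a)
    (h1 : ∀ n, ‖a n‖ < 1) (n : ℕ) (p : Polynomial ℂ) (v : ℂ) :
    ∃ q : Polynomial ℂ, q.eval (a n) = v ∧ (∀ m < n, q.eval (a m) = p.eval (a m)) ∧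
      (a n ≠ 0 → ∀ z : ℂ, ‖z‖ ≤ ‖a n‖ ^ 2 → ‖(q - p).eval z‖ ≤ (1 / 2) ^ n) := by
  classical
  set P : Polynomial ℂ :=
    ∏ m ∈ Finset.range n, (Polynomial.C (a n - a m)⁻¹ * (Polynomial.X - Polynomial.C (a m)))
    with hP
  have hPn : P.eval (a n) = 1 := by
    rw [hP, Polynomial.eval_prod]
    refine Finset.prod_eq_one fun m hm ↦ ?_
    have : a n - a m ≠ 0 := sub_ne_zero.2 fun h ↦ (Finset.mem_range.1 hm).ne' (ha h)
    simp [this]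
  have hPm : ∀ m < n, P.eval (a m) = 0 := by
    intro m hm
    rw [hP, Polynomial.eval_prod]
    exact Finset.prod_eq_zero (Finset.mem_range.2 hm) (by simp)
  set c := v - p.eval (a n) with hc
  by_cases h0 : a n = 0
  · refine ⟨p + Polynomial.C c * P, ?_, ?_, fun h ↦ absurd h0 h⟩
    · simp [hPn, hc]
    · intro m hm; simp [hPm m hm]
  · obtain ⟨M, hM⟩ : ∃ M, ∀ z ∈ Metric.closedBall (0 : ℂ) 1, ‖P.eval z‖ ≤ M :=
      (isCompact_closedBall 0 1).exists_bound_of_continuousOn P.continuous.continuousOn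
    have hM0 : 0 ≤ M := (norm_nonneg _).trans (hM 0 (by simp))
    obtain ⟨k, hk⟩ : ∃ k : ℕ, ‖c‖ * M * ‖a n‖ ^ k < (1 / 2) ^ n := by
      have := (tendsto_pow_atTop_nhds_zero_of_lt_one (norm_nonneg (a n)) (h1 n)).const_mul
        (‖c‖ * M)
      rw [mul_zero] at this
      exact (this.eventually_lt_const (by positivity)).exists
    refine ⟨p + Polynomial.C c * P * (Polynomial.C (a n)⁻¹ * Polynomial.X) ^ k, ?_, ?_, ?_⟩
    · simp [hPn, hc, h0]
    · intro m hm; simp [hPm m hm]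
    · intro _ z hz
      have hz1 : ‖z‖ ≤ 1 := hz.trans (pow_le_one₀ (norm_nonneg _) (h1 n).le)
      have hq : ‖(a n)⁻¹ * z‖ ≤ ‖a n‖ := by
        rw [norm_mul, norm_inv, inv_mul_le_iff₀ (norm_pos_iff.2 h0)]
        simpa [sq] using hz
      have : (p + Polynomial.C c * P * (Polynomial.C (a n)⁻¹ * Polynomial.X) ^ k - p).eval z =
          c * P.eval z * ((a n)⁻¹ * z) ^ k := by simp
      rw [this, norm_mul, norm_mul, norm_pow]
      refine le_trans ?_ hk.le
      gcongr
      exact hM z (by simpa using hz1)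

/-- A sequence of distinct points of the unit disc tending to its boundary is interpolated by
holomorphic functions on the disc. -/
theorem exists_differentiableOn_ball_interpolate (a : ℕ → ℂ) (ha : Function.Injective a)
    (h1 : ∀ n, ‖a n‖ < 1) (ht : Tendsto (fun n ↦ ‖a n‖) atTop (𝓝 1)) (v : ℕ → ℂ) :
    ∃ f : ℂ → ℂ, DifferentiableOn ℂ f (Metric.ball 0 1) ∧ ∀ n, f (a n) = v n := by
  choose q hqn hqm hqb using exists_polynomial_interpolate_step a ha h1
  let F : ℕ → Polynomial ℂ := fun n ↦ Nat.rec 0 (fun n p ↦ q n p (v n)) n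
  have hF : ∀ n, F (n + 1) = q n (F n) (v n) := fun n ↦ rfl
  have hF0 : F 0 = 0 := rfl
  have hval : ∀ m n, m < n → (F n).eval (a m) = v m := by
    intro m n hmn
    induction n, hmn using Nat.le_induction with
    | base => rw [hF, hqn]
    | succ n hn ih => rw [hF, hqm _ _ _ _ hn, ih]
  -- A telescoping series: at `a m` only the terms with `n ≤ m` survive, while near a given point
  -- all but finitely many terms are geometrically small.
  refine ⟨fun z ↦ ∑' n, (F (n + 1) - F n).eval z, ?_, ?_⟩
  · intro z hz
    rw [mem_ball_zero_iff] at hz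
    obtain ⟨r, hzr, hr1⟩ := exists_between hz
    have hr0 : 0 < r := (norm_nonneg z).trans_lt hzr
    have hev : ∀ᶠ n in atTop, r < ‖a n‖ ^ 2 :=
      (by simpa using ht.pow 2 : Tendsto (fun n ↦ ‖a n‖ ^ 2) atTop (𝓝 1)).eventually_const_lt hr1
    have hb : ∀ n, ∃ M : ℝ, (∀ w ∈ Metric.ball (0 : ℂ) r, ‖(F (n + 1) - F n).eval w‖ ≤ M) ∧
        (r < ‖a n‖ ^ 2 → M = (1 / 2) ^ n) := by
      intro n
      by_cases hn : r < ‖a n‖ ^ 2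
      · refine ⟨(1 / 2) ^ n, fun w hw ↦ ?_, fun _ ↦ rfl⟩
        rw [mem_ball_zero_iff] at hw
        exact hqb n (F n) (v n) (fun h ↦ by simp [h] at hn; linarith) w (hw.trans hn).le
      · obtain ⟨M, hM⟩ := (isCompact_closedBall (0 : ℂ) r).exists_bound_of_continuousOn
          (F (n + 1) - F n).continuous.continuousOn
        exact ⟨M, fun w hw ↦ hM w (Metric.ball_subset_closedBall hw), fun h ↦ absurd h hn⟩
    choose u hu huev using hb
    have hsum : Summable u := by
      refine (summable_geometric_two).congr_atTop ?_
      filter_upwards [hev] with n hn using (huev n hn).symm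
    have := Complex.differentiableOn_tsum_of_summable_norm hsum
      (F := fun n w ↦ (F (n + 1) - F n).eval w)
      (fun n ↦ (Polynomial.differentiable _).differentiableOn) Metric.isOpen_ball hu
    exact (this.differentiableAt (Metric.isOpen_ball.mem_nhds
      (by simpa using hzr))).differentiableWithinAt
  · intro m
    have hz : ∀ n ∉ Finset.range (m + 1), (F (n + 1) - F n).eval (a m) = 0 := by
      intro n hn
      have hn : m < n := by simpa using hn
      rw [Polynomial.eval_sub, hval m n hn, hval m (n + 1) (by omega), sub_self]
    change ∑' n, (F (n + 1) - F n).eval (a m) = v m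
    rw [tsum_eq_sum hz]
    simp_rw [Polynomial.eval_sub]
    rw [Finset.sum_range_sub (fun n ↦ (F n).eval (a m)), hval m (m + 1) (by omega), hF0]
    simp

end Interpolation

/-! ### Holomorphic functions and discrete sets in the disc -/

section Disc

theorem contMDiff_comp_val_of_differentiableOn {f : ℂ → ℂ}
    (hf : DifferentiableOn ℂ f (Metric.ball 0 1)) :
    ContMDiff 𝓘(ℂ, ℂ) 𝓘(ℂ, ℂ) ω (fun z : unitDisc ↦ f z) := by
  have h : ContMDiffOn 𝓘(ℂ, ℂ) 𝓘(ℂ, ℂ) ω f (Metric.ball 0 1) :=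
    ((hf.analyticOnNhd Metric.isOpen_ball).contDiffOn
      Metric.isOpen_ball.uniqueDiffOn).contMDiffOn
  exact h.comp_contMDiff contMDiff_subtype_val fun z ↦ z.2

theorem differentiableOn_of_contMDiff_comp_val {f : ℂ → ℂ}
    (hf : ContMDiff 𝓘(ℂ, ℂ) 𝓘(ℂ, ℂ) ω (fun z : unitDisc ↦ f z)) :
    DifferentiableOn ℂ f (Metric.ball 0 1) := by
  intro z hz
  have h := contMDiffAt_subtype_iff.1 (hf ⟨z, hz⟩)
  exact (h.contDiffAt.differentiableAt (by simp)).differentiableWithinAt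

theorem norm_lt_one (z : unitDisc) : ‖(z : ℂ)‖ < 1 := mem_ball_zero_iff.1 z.2

theorem IsInfiniteDiscreteSubset.finite_inter_isCompact {X : Type*} [TopologicalSpace X]
    {D : Set X} (hD : IsInfiniteDiscreteSubset D) {K : Set X} (hK : IsCompact K) :
    (D ∩ K).Finite :=
  (hK.inter_left hD.isClosed).finite
    (IsDiscrete.mono ⟨hD.discrete⟩ inter_subset_left)

theorem isCompact_norm_le (r : ℝ) (hr : r < 1) : IsCompact {z : unitDisc | ‖(z : ℂ)‖ ≤ r} := by
  rw [Topology.IsEmbedding.subtypeVal.isCompact_iff]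
  convert isCompact_closedBall (0 : ℂ) r
  ext z
  simp only [mem_image, mem_ofPred_eq, mem_closedBall_zero_iff]
  exact ⟨fun ⟨w, hw, h⟩ ↦ h ▸ hw, fun h ↦ ⟨⟨z, mem_ball_zero_iff.2 (h.trans_lt hr)⟩, h, rfl⟩⟩

/-- Holomorphic functions on the disc take arbitrary values on an infinite discrete subset. -/
theorem IsInfiniteDiscreteSubset.exists_interpolate {D : Set unitDisc}
    (hD : IsInfiniteDiscreteSubset D) (v : D → ℂ) :
    ∃ f : ℂ → ℂ, DifferentiableOn ℂ f (Metric.ball 0 1) ∧ ∀ z : D, f (z : unitDisc) = v z := by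
  have := hD.discrete
  have : Countable D := countable_of_Lindelof_of_discrete
  have : Infinite D := hD.infinite.to_subtype
  obtain ⟨_⟩ := nonempty_denumerable D
  let e : ℕ ≃ D := (Denumerable.eqv D).symm
  have hinj : Function.Injective fun n ↦ ((e n : unitDisc) : ℂ) :=
    Subtype.val_injective.comp (Subtype.val_injective.comp e.injective)
  have ht : Tendsto (fun n ↦ ‖((e n : unitDisc) : ℂ)‖) atTop (𝓝 1) := by
    rw [tendsto_order]
    refine ⟨fun r hr ↦ ?_, fun r hr ↦ .of_forall fun n ↦ (norm_lt_one _).trans hr⟩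
    have hfin : {n | ‖((e n : unitDisc) : ℂ)‖ ≤ r}.Finite := by
      refine ((hD.finite_inter_isCompact (isCompact_norm_le r hr)).preimage
        (Subtype.val_injective.comp e.injective).injOn).subset fun n hn ↦ ?_
      exact ⟨(e n).2, hn⟩
    rw [← Nat.cofinite_eq_atTop]
    filter_upwards [hfin.compl_mem_cofinite] with n hn
    simpa using hn
  obtain ⟨f, hf, hfv⟩ := exists_differentiableOn_ball_interpolate _ hinj
    (fun n ↦ norm_lt_one _) ht (fun n ↦ v (e n))
  exact ⟨f, hf, fun z ↦ by simpa using hfv (e.symm z)⟩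

end Disc

/-! ### Shears, and automorphisms over the disc -/

section Product

/-- The automorphism `(z, w) ↦ (z, w + f z)`. -/
noncomputable def shear (f : ℂ → ℂ) (hf : DifferentiableOn ℂ f (Metric.ball 0 1)) :
    HolAut discTimesPlaneModel (unitDisc × ℂ) where
  toFun x := (x.1, x.2 + f x.1)
  invFun x := (x.1, x.2 - f x.1)
  left_inv x := by simp
  right_inv x := by simp
  contMDiff_toFun := contMDiff_fst.prodMk
    (contMDiff_snd.add ((contMDiff_comp_val_of_differentiableOn hf).comp contMDiff_fst))
  contMDiff_invFun := contMDiff_fst.prodMk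
    (contMDiff_snd.sub ((contMDiff_comp_val_of_differentiableOn hf).comp contMDiff_fst))

theorem IsInfiniteDiscreteSubset.prod_singleton {D : Set unitDisc}
    (hD : IsInfiniteDiscreteSubset D) :
    IsInfiniteDiscreteSubset (D ×ˢ ({0} : Set ℂ)) where
  infinite := hD.infinite.prod_left (singleton_nonempty 0)
  isClosed := hD.isClosed.prod isClosed_singleton
  discrete := by
    have := hD.discrete
    refine DiscreteTopology.of_continuous_injective
      (f := fun x : ↥(D ×ˢ ({0} : Set ℂ)) ↦ (⟨x.1.1, x.2.1⟩ : D)) (by fun_prop) ?_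
    rintro ⟨⟨x, y⟩, hx, hy⟩ ⟨⟨x', y'⟩, hx', hy'⟩ h
    simp only [mem_singleton_iff] at hy hy'
    simp only [Subtype.mk.injEq] at h
    simp [h, hy, hy']

theorem IsInfiniteDiscreteSubset.isTame_prod_singleton {D : Set unitDisc}
    (hD : IsInfiniteDiscreteSubset D) :
    IsTame discTimesPlaneModel (D ×ˢ ({0} : Set ℂ)) where
  isInfiniteDiscreteSubset := hD.prod_singleton
  exists_aut ρ hρ ζ := by
    have hR : ∀ z : D, ∃ w : ℂ, ζ ⟨(z, 0), z.2, rfl⟩ ≤ ρ (z, w) := by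
      intro z
      -- Otherwise the whole fibre over `z` lies in one compact sublevel set, whose projection would
      -- make `ℂ` compact.
      by_contra! h
      have hK := (hρ.isCompact_sublevel (ζ ⟨(z, 0), z.2, rfl⟩)).image continuous_snd
      refine noncompact_univ ℂ (hK.of_isClosed_subset isClosed_univ fun w _ ↦ ?_)
      exact ⟨(z, w), (h w).le, rfl⟩
    choose v hv using hR
    obtain ⟨f, hf, hfv⟩ := hD.exists_interpolate v
    refine ⟨shear f hf, ?_⟩
    rintro ⟨⟨z, w⟩, hz, hw⟩
    obtain rfl : w = 0 := hw
    have : shear f hf (z, 0) = (z, v ⟨z, hz⟩) := by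
      change (z, 0 + f z) = _
      rw [zero_add, ← hfv ⟨z, hz⟩]
    rw [this]
    exact hv ⟨z, hz⟩

/-- Liouville: on a fibre the first component is a bounded entire function. -/
theorem fst_apply_eq (φ : HolAut discTimesPlaneModel (unitDisc × ℂ)) (z : unitDisc) (w w' : ℂ) :
    (φ (z, w)).1 = (φ (z, w')).1 := by
  have h : ContMDiff 𝓘(ℂ, ℂ) 𝓘(ℂ, ℂ) ω fun w : ℂ ↦ ((φ (z, w)).1 : ℂ) :=
    contMDiff_subtype_val.comp
      (contMDiff_fst.comp (φ.contMDiff.comp (contMDiff_const.prodMk contMDiff_id)))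
  have hd : Differentiable ℂ fun w : ℂ ↦ ((φ (z, w)).1 : ℂ) := h.contDiff.differentiable (by simp)
  refine Subtype.ext (hd.apply_eq_apply_of_bounded ?_ w w')
  refine (Metric.isBounded_ball (x := (0 : ℂ)) (r := 1)).subset ?_
  rintro _ ⟨w, rfl⟩
  exact (φ (z, w)).1.2

/-- The automorphism of the disc induced by an automorphism of its product with the plane. -/
noncomputable def baseAut (φ : HolAut discTimesPlaneModel (unitDisc × ℂ)) : HolAut 𝓘(ℂ, ℂ) unitDisc where
  toFun z := (φ (z, 0)).1
  invFun z := (φ.symm (z, 0)).1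
  left_inv z := by
    change (φ.symm ((φ (z, 0)).1, 0)).1 = z
    rw [fst_apply_eq φ.symm _ 0 (φ (z, 0)).2]
    simp
  right_inv z := by
    change (φ ((φ.symm (z, 0)).1, 0)).1 = z
    rw [fst_apply_eq φ _ 0 (φ.symm (z, 0)).2]
    simp
  contMDiff_toFun :=
    contMDiff_fst.comp (φ.contMDiff.comp (contMDiff_id.prodMk contMDiff_const))
  contMDiff_invFun :=
    contMDiff_fst.comp (φ.symm.contMDiff.comp (contMDiff_id.prodMk contMDiff_const))

theorem AreEquivalent.of_prod_singleton {D D' : Set unitDisc}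
    (h : AreEquivalent discTimesPlaneModel (D ×ˢ ({0} : Set ℂ)) (D' ×ˢ ({0} : Set ℂ))) :
    AreEquivalent 𝓘(ℂ, ℂ) D D' := by
  obtain ⟨φ, hφ⟩ := h
  refine ⟨baseAut φ, ?_⟩
  have h1 : ∀ S : Set unitDisc, Prod.fst '' (S ×ˢ ({0} : Set ℂ)) = S :=
    fun S ↦ fst_image_prod S (singleton_nonempty 0)
  rw [← h1 D', ← hφ, prod_singleton, image_image, image_image]
  rfl

end Product

/-! ### Schwarz lemma and the Blaschke condition -/

section Blaschke

theorem one_sub_norm_sq_mobius (b w : ℂ) (h : 1 - starRingEnd ℂ b * w ≠ 0) :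
    1 - ‖(w - b) / (1 - starRingEnd ℂ b * w)‖ ^ 2 =
      (1 - ‖b‖ ^ 2) * (1 - ‖w‖ ^ 2) / ‖1 - starRingEnd ℂ b * w‖ ^ 2 := by
  have h' : ‖1 - starRingEnd ℂ b * w‖ ^ 2 ≠ 0 := by simpa using h
  rw [norm_div, div_pow, eq_div_iff h', sub_mul, div_mul_cancel₀ _ h']
  simp only [Complex.sq_norm, Complex.normSq_apply, Complex.sub_re, Complex.sub_im, Complex.mul_re,
    Complex.mul_im, Complex.conj_re, Complex.conj_im, Complex.one_re, Complex.one_im]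
  ring

/-- Holomorphic self-maps of the disc do not decrease the distance to the boundary
by more than a constant factor. -/
theorem exists_pos_mul_one_sub_norm_sq_le {f : ℂ → ℂ}
    (hf : DifferentiableOn ℂ f (Metric.ball 0 1))
    (hm : MapsTo f (Metric.ball 0 1) (Metric.ball 0 1)) :
    ∃ c > 0, ∀ z, ‖z‖ < 1 → c * (1 - ‖z‖ ^ 2) ≤ 1 - ‖f z‖ ^ 2 := by
  set b := f 0 with hb
  have hb1 : ‖b‖ < 1 := mem_ball_zero_iff.1 (hm (by simp))
  have hlow : ∀ w : ℂ, ‖w‖ < 1 → 1 - ‖b‖ ≤ ‖1 - starRingEnd ℂ b * w‖ := by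
    intro w hw
    have h1 := norm_sub_norm_le (1 : ℂ) (starRingEnd ℂ b * w)
    rw [norm_one, norm_mul, RCLike.norm_conj] at h1
    nlinarith [norm_nonneg b]
  have hne : ∀ w : ℂ, ‖w‖ < 1 → 1 - starRingEnd ℂ b * w ≠ 0 := fun w hw ↦
    norm_pos_iff.1 ((sub_pos.2 hb1).trans_le (hlow w hw))
  have hbb : 0 < 1 - ‖b‖ ^ 2 := by nlinarith [norm_nonneg b]
  -- The constant comes from applying the Schwarz lemma to `f` followed by the Möbius map taking `b
  -- = f 0` to 0, with its denominator bounded below by `1 - ‖b‖`.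
  refine ⟨(1 - ‖b‖) ^ 2 / (1 - ‖b‖ ^ 2), div_pos (pow_pos (sub_pos.2 hb1) 2) hbb, fun z hz ↦ ?_⟩
  have hfz : ∀ z ∈ Metric.ball (0 : ℂ) 1, ‖f z‖ < 1 := fun z hz ↦ mem_ball_zero_iff.1 (hm hz)
  have key := Complex.norm_le_norm_of_mapsTo_ball (R := 1)
    (f := fun z ↦ (f z - b) / (1 - starRingEnd ℂ b * f z))
    ((hf.sub_const b).div ((hf.const_mul _).const_sub 1) fun z hz ↦ hne _ (hfz z hz))
    (fun z hz ↦ by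
      have h1 := one_sub_norm_sq_mobius b (f z) (hne _ (hfz z hz))
      have h2 : 0 ≤ (1 - ‖b‖ ^ 2) * (1 - ‖f z‖ ^ 2) / ‖1 - starRingEnd ℂ b * f z‖ ^ 2 := by
        have : 0 ≤ 1 - ‖f z‖ ^ 2 := by nlinarith [norm_nonneg (f z), hfz z hz]
        positivity
      rw [mem_closedBall_zero_iff]
      exact (sq_le_one_iff₀ (norm_nonneg _)).1 (by linarith))
    (by simp [hb]) hz
  have hw1 := hfz z (by simpa using hz)
  have h1 := one_sub_norm_sq_mobius b (f z) (hne _ hw1)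
  have h3 : 1 - ‖z‖ ^ 2 ≤ (1 - ‖b‖ ^ 2) * (1 - ‖f z‖ ^ 2) / ‖1 - starRingEnd ℂ b * f z‖ ^ 2 := by
    rw [← h1]
    gcongr
  have h4 : 0 ≤ 1 - ‖f z‖ ^ 2 := by nlinarith [norm_nonneg (f z)]
  have h5 : 1 - ‖z‖ ^ 2 ≤ (1 - ‖b‖ ^ 2) * (1 - ‖f z‖ ^ 2) / (1 - ‖b‖) ^ 2 := by
    refine h3.trans ?_
    have := hlow _ hw1
    have := sub_pos.2 hb1
    gcongr
  rw [le_div_iff₀ (pow_pos (sub_pos.2 hb1) 2)] at h5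
  rw [div_mul_eq_mul_div, div_le_iff₀ hbb]
  linarith

/-- The Blaschke condition is invariant under automorphisms of the disc. -/
theorem AreEquivalent.summable_one_sub_norm_sq {D D' : Set unitDisc}
    (h : AreEquivalent 𝓘(ℂ, ℂ) D D')
    (hs : Summable fun z : D' ↦ 1 - ‖((z : unitDisc) : ℂ)‖ ^ 2) :
    Summable fun z : D ↦ 1 - ‖((z : unitDisc) : ℂ)‖ ^ 2 := by
  classical
  obtain ⟨g, rfl⟩ := h
  let f : ℂ → ℂ := fun z ↦ if hz : z ∈ unitDisc then g ⟨z, hz⟩ else 0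
  have hfg : ∀ z : unitDisc, f z = g z := fun z ↦ dif_pos z.2
  have hf : DifferentiableOn ℂ f (Metric.ball 0 1) := by
    refine differentiableOn_of_contMDiff_comp_val ?_
    rw [funext hfg]
    exact contMDiff_subtype_val.comp g.contMDiff
  obtain ⟨c, hc, hle⟩ := exists_pos_mul_one_sub_norm_sq_le hf
    fun z hz ↦ by rw [hfg ⟨z, hz⟩]; exact (g ⟨z, hz⟩).2
  have hs' := (hs.comp_injective
    (Equiv.Set.image g D g.injective).injective).mul_left c⁻¹
  refine Summable.of_nonneg_of_le (fun z ↦ ?_) (fun z ↦ ?_) hs'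
  · nlinarith [norm_nonneg ((z : unitDisc) : ℂ), norm_lt_one (z : unitDisc)]
  · rw [← div_eq_inv_mul, le_div_iff₀' hc]
    simpa [hfg] using hle (z : unitDisc) (norm_lt_one _)

/-- The points `1 - u n` of the disc. -/
noncomputable def oneSub (u : ℕ → ℝ) (hu : ∀ n, u n ∈ Ioo (0 : ℝ) 1) (n : ℕ) : unitDisc :=
  ⟨((1 - u n : ℝ) : ℂ), by
    have := hu n
    refine mem_ball_zero_iff.2 ?_
    rw [Complex.norm_real, Real.norm_eq_abs, abs_lt]
    exact ⟨by linarith [this.2], by linarith [this.1]⟩⟩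

theorem norm_oneSub (u : ℕ → ℝ) (hu : ∀ n, u n ∈ Ioo (0 : ℝ) 1) (n : ℕ) :
    ‖(oneSub u hu n : ℂ)‖ = 1 - u n := by
  change ‖((1 - u n : ℝ) : ℂ)‖ = _
  rw [Complex.norm_real, Real.norm_eq_abs, abs_of_pos (sub_pos.2 (hu n).2)]

theorem oneSub_injective {u : ℕ → ℝ} (hu : ∀ n, u n ∈ Ioo (0 : ℝ) 1)
    (hinj : Function.Injective u) : Function.Injective (oneSub u hu) := by
  intro m n h
  have := norm_oneSub u hu m
  rw [h, norm_oneSub] at this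
  exact hinj (by linarith)

theorem isInfiniteDiscreteSubset_range_oneSub {u : ℕ → ℝ} (hu : ∀ n, u n ∈ Ioo (0 : ℝ) 1)
    (hinj : Function.Injective u) (ht : Tendsto u atTop (𝓝 0)) :
    IsInfiniteDiscreteSubset (range (oneSub u hu)) := by
  -- Closedness of every subset yields closedness and discreteness of the range at once.
  have hlf : ∀ S ⊆ range (oneSub u hu), IsClosed S := by
    intro S hS
    rw [← isOpen_compl_iff, isOpen_iff_mem_nhds]
    intro z hz
    obtain ⟨r, hzr, hr1⟩ := exists_between (norm_lt_one z)
    have hfin : (S ∩ {w : unitDisc | ‖(w : ℂ)‖ < r}).Finite := by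
      have hev : ∀ᶠ n in cofinite, u n < 1 - r := by
        rw [Nat.cofinite_eq_atTop]
        exact ht.eventually_lt_const (by linarith)
      refine ((eventually_cofinite.1 hev).image (oneSub u hu)).subset ?_
      rintro w ⟨hw, hwr⟩
      obtain ⟨n, rfl⟩ := hS hw
      refine ⟨n, ?_, rfl⟩
      rw [mem_ofPred_eq, norm_oneSub] at hwr
      simp only [mem_ofPred_eq, not_lt]
      linarith
    have hop : IsOpen {w : unitDisc | ‖(w : ℂ)‖ < r} :=
      isOpen_lt (by fun_prop) continuous_const
    filter_upwards [hop.mem_nhds hzr, hfin.isClosed.isOpen_compl.mem_nhds fun h ↦ hz h.1]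
      with w hw hw' hwS using hw' ⟨hwS, hw⟩
  refine ⟨infinite_range_of_injective (oneSub_injective hu hinj), hlf _ subset_rfl, ?_⟩
  rw [discreteTopology_iff_forall_isClosed]
  intro S
  have := (hlf (Subtype.val '' S) (by rintro _ ⟨x, _, rfl⟩; exact x.2)).preimage
    (continuous_subtype_val (p := (· ∈ range (oneSub u hu))))
  rwa [preimage_image_eq _ Subtype.val_injective] at this

/-- `1 - (1 - u) ^ 2 = u * (2 - u)` lies between `u` and `2 * u`. -/
theorem summable_range_oneSub_iff {u : ℕ → ℝ} (hu : ∀ n, u n ∈ Ioo (0 : ℝ) 1)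
    (hinj : Function.Injective u) :
    (Summable fun z : range (oneSub u hu) ↦ 1 - ‖((z : unitDisc) : ℂ)‖ ^ 2) ↔ Summable u := by
  rw [← (Equiv.ofInjective _ (oneSub_injective hu hinj)).summable_iff]
  have : ((fun z : range (oneSub u hu) ↦ 1 - ‖((z : unitDisc) : ℂ)‖ ^ 2) ∘
      Equiv.ofInjective _ (oneSub_injective hu hinj)) = fun n ↦ 1 - (1 - u n) ^ 2 := by
    funext n
    simp [norm_oneSub]
  rw [this]
  refine ⟨fun h ↦ .of_nonneg_of_le (fun n ↦ (hu n).1.le) (fun n ↦ ?_) h,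
    fun h ↦ .of_nonneg_of_le (fun n ↦ ?_) (fun n ↦ ?_) (h.mul_left 2)⟩ <;>
  nlinarith [(hu n).1, (hu n).2]

theorem exists_not_areEquivalent_unitDisc :
    ∃ D D' : Set unitDisc, IsInfiniteDiscreteSubset D ∧ IsInfiniteDiscreteSubset D' ∧
      ¬ AreEquivalent 𝓘(ℂ, ℂ) D D' := by
  -- The harmonic sequence starts at `1/2`, since its term 1 is excluded from the open interval.
  have hu : ∀ n : ℕ, 1 / ((n + 1 : ℕ) + 1 : ℝ) ∈ Ioo (0 : ℝ) 1 := fun n ↦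
    ⟨by positivity, (div_lt_one (by positivity)).2 (by push_cast; linarith [n.cast_nonneg (α := ℝ)])⟩
  have hv : ∀ n : ℕ, (1 / 2 : ℝ) ^ (n + 1) ∈ Ioo (0 : ℝ) 1 := fun n ↦
    ⟨by positivity, pow_lt_one₀ (by norm_num) (by norm_num) (by simp)⟩
  have hui : Function.Injective fun n : ℕ ↦ 1 / ((n + 1 : ℕ) + 1 : ℝ) := by
    intro m n h
    simpa using h
  have hvi : Function.Injective fun n : ℕ ↦ (1 / 2 : ℝ) ^ (n + 1) :=
    (pow_right_injective₀ (by norm_num) (by norm_num)).comp (add_left_injective 1)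
  refine ⟨_, _, isInfiniteDiscreteSubset_range_oneSub hu hui ?_,
    isInfiniteDiscreteSubset_range_oneSub hv hvi ?_, fun h ↦ ?_⟩
  · exact (tendsto_add_atTop_iff_nat 1).2 (tendsto_one_div_add_atTop_nhds_zero_nat (𝕜 := ℝ))
  · exact (tendsto_add_atTop_iff_nat 1).2
      (tendsto_pow_atTop_nhds_zero_of_lt_one (by norm_num) (by norm_num))
  · have hs := h.summable_one_sub_norm_sq ((summable_range_oneSub_iff hv hvi).2
      ((summable_nat_add_iff 1).2 summable_geometric_two))
    rw [summable_range_oneSub_iff hu hui] at hs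
    refine Real.not_summable_one_div_natCast ((summable_nat_add_iff 2).1 (hs.congr fun n ↦ ?_))
    push_cast
    ring

end Blaschke

end TameSets

theorem mainTheorem11 :
    -- there are inequivalent tame discrete subsets in the product of the unit disc and the plane
    (∃ S S' : Set (TameSets.unitDisc × ℂ),
      TameSets.IsTame TameSets.discTimesPlaneModel S ∧
      TameSets.IsTame TameSets.discTimesPlaneModel S' ∧
      ¬ TameSets.AreEquivalent TameSets.discTimesPlaneModel S S') ∧
    -- every infinite discrete subset of the disc gives a tame subset of the product
    (∀ D : Set TameSets.unitDisc, TameSets.IsInfiniteDiscreteSubset D →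
      TameSets.IsTame TameSets.discTimesPlaneModel (D ×ˢ ({0} : Set ℂ))) ∧
    -- inequivalent subsets of the disc give inequivalent subsets of the product
    (∀ D D' : Set TameSets.unitDisc, TameSets.IsInfiniteDiscreteSubset D →
      TameSets.IsInfiniteDiscreteSubset D' →
      ¬ TameSets.AreEquivalent 𝓘(ℂ, ℂ) D D' →
      ¬ TameSets.AreEquivalent TameSets.discTimesPlaneModel
        (D ×ˢ ({0} : Set ℂ)) (D' ×ˢ ({0} : Set ℂ))) ∧
    -- there are inequivalent infinite discrete subsets of the disc
    (∃ D D' : Set TameSets.unitDisc, TameSets.IsInfiniteDiscreteSubset D ∧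
      TameSets.IsInfiniteDiscreteSubset D' ∧
      ¬ TameSets.AreEquivalent 𝓘(ℂ, ℂ) D D') := by
  obtain ⟨D, D', hD, hD', hn⟩ := TameSets.exists_not_areEquivalent_unitDisc
  exact ⟨⟨_, _, hD.isTame_prod_singleton, hD'.isTame_prod_singleton,
      fun h ↦ hn h.of_prod_singleton⟩,
    fun _ h ↦ h.isTame_prod_singleton, fun _ _ _ _ h h' ↦ h h'.of_prod_singleton,
    D, D', hD, hD', hn⟩
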